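/- Let $(X,d)$ be a metric space. All quantities below take values in $[0,\infty]$, with $\sup\emptyset=0$ and $\inf\emptyset=\infty$. For $A\subseteq X$, the outer linear measure (one-dimensional Hausdorff outer measure) of $A$ is \[ L^*(A)=\sup_{\delta>0}\ \inf\Bigl\{\sum_{i\in\mathbb N}\operatorname{diam}(U_i) : U_i\subseteq X,\ A\subseteq\bigcup_{i\in\mathbb N}U_i,\ \operatorname{diam}(U_i)\le\delta\text{ for all }i\Bigr\}. \] For a finite simple graph $G=(V,E)$ whose vertex set $V$ is a non-empty finite subset of $X$, put $\ell(G)=\sum_{\{a,b\}\in E}d(a,b)$. For a finite non-empty set $P\subseteq X$ and a set $A\subseteq X$ define \[ \operatorname{smt}(P)=\inf\{\ell(G): G=(V,E)\text{ is connected},\ P\subseteq V\subseteq X\}, \] \[ \operatorname{smt}_A(P)=\inf\{\ell(G): G=(V,E)\text{ is connected},\ P\subseteq V\subseteq X,\ V\setminus P\subseteq A\}. \] The Menger--Choquet length and the intrinsic Menger length of $A\subseteq X$ are \[ L_{MC}(A)=\sup\{\operatorname{smt}(P): P\subseteq A\text{ finite, non-empty}\},\qquad L_{IM}(A)=\sup\{\operatorname{smt}_A(P):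 P\subseteq A\text{ finite, non-empty}\}. \] \textbf{Theorem.} For every metric space $X$ and every subset $A\subseteq X$, \[ L^*(A)\le L_{MC}(A)\le L_{IM}(A). \] If, moreover, $A$ is connected (the empty set being allowed), then \[ L^*(A)=L_{MC}(A)=L_{IM}(A). \] -/

import Mathlib

open scoped ENNReal NNReal

/-- `L*_δ(A)`: the infimum of `∑ diam (U i)` over the countable `δ`-covers `(U i)` of `A`. -/
noncomputable def outerLinearPremeasure {X : Type*} [MetricSpace X] (δ : ℝ≥0) (A : Set X) :
    ℝ≥0∞ :=
  ⨅ (U : ℕ → Set X) (_ : A ⊆ ⋃ i, U i) (_ : ∀ i, Metric.ediam (U i) ≤ δ),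
    ∑' i, Metric.ediam (U i)

/-- Outer linear measure `L*(A)`, i.e. one-dimensional Hausdorff outer measure
(see `outerLinearMeasure_eq_hausdorffMeasure`). -/
noncomputable def outerLinearMeasure {X : Type*} [MetricSpace X] (A : Set X) : ℝ≥0∞ :=
  ⨆ (δ : ℝ≥0) (_ : 0 < δ), outerLinearPremeasure δ A

/-- The outer linear measure is Mathlib's one-dimensional Hausdorff measure. -/
theorem outerLinearMeasure_eq_hausdorffMeasure {X : Type*} [MetricSpace X]
    [MeasurableSpace X] [BorelSpace X] (A : Set X) :
    outerLinearMeasure A = MeasureTheory.Measure.hausdorffMeasure 1 A := by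
  have key : ∀ s : Set X, (⨆ _ : s.Nonempty, Metric.ediam s ^ (1 : ℝ)) = Metric.ediam s := by
    intro s
    rcases s.eq_empty_or_nonempty with rfl | h
    · simp
    · simp [h]
  rw [MeasureTheory.Measure.hausdorffMeasure_apply]
  simp only [key, outerLinearMeasure, outerLinearPremeasure]
  apply le_antisymm
  · refine iSup₂_le fun δ hδ => ?_
    exact le_iSup₂_of_le (δ : ℝ≥0∞) (by exact_mod_cast hδ) le_rfl
  · refine iSup₂_le fun r hr => ?_
    obtain ⟨δ, hδ, hδr⟩ := ENNReal.lt_iff_exists_nnreal_btwn.1 hr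
    refine le_iSup₂_of_le δ (by exact_mod_cast hδ) ?_
    refine iInf_mono fun U => iInf_mono fun _ => ?_
    exact le_iInf fun h => iInf_le_of_le (fun i => (h i).trans hδr.le) le_rfl

/-- The distance between the two endpoints of an unordered pair of points. -/
noncomputable def edgeLength {Y : Type*} [MetricSpace Y] : Sym2 Y → ℝ≥0∞ :=
  Sym2.lift ⟨fun a b => edist a b, fun a b => edist_comm a b⟩

open scoped Classical in
/-- The length `ℓ(G)` of a graph `G` on a finite set `V` of points of a metric space: the sum
of `d(a, b)` over all edges `{a, b}` of `G`. -/
noncomputable def graphLength {X : Type*} [MetricSpace X] {V : Finset X} (G : SimpleGraph V) :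
    ℝ≥0∞ :=
  ∑ e ∈ G.edgeFinset, edgeLength e

/-- `smt(P)`: the infimum of the lengths of connected graphs on finite vertex sets `V` with
`P ⊆ V ⊆ X`. -/
noncomputable def smt {X : Type*} [MetricSpace X] (P : Finset X) : ℝ≥0∞ :=
  ⨅ (V : Finset X) (_ : P ⊆ V) (G : SimpleGraph V) (_ : G.Connected), graphLength G

/-- `smt_A(P)`: as `smt(P)`, with all Steiner points (the points of `V \ P`) in `A`. -/
noncomputable def smtIn {X : Type*} [MetricSpace X] (A : Set X) (P : Finset X) : ℝ≥0∞ :=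
  ⨅ (V : Finset X) (_ : P ⊆ V) (_ : (V : Set X) \ (P : Set X) ⊆ A)
    (G : SimpleGraph V) (_ : G.Connected), graphLength G

/-- Menger–Choquet length `L_MC(A)`. -/
noncomputable def mengerChoquetLength {X : Type*} [MetricSpace X] (A : Set X) : ℝ≥0∞ :=
  ⨆ (P : Finset X) (_ : P.Nonempty) (_ : (P : Set X) ⊆ A), smt P

/-- Intrinsic Menger length `L_IM(A)`. As for `L_MC`, the finite sets `P` are non-empty; this
makes a difference only for `A = ∅`, where it gives the value `0`. -/
noncomputable def intrinsicMengerLength {X : Type*} [MetricSpace X] (A : Set X) : ℝ≥0∞ :=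
  ⨆ (P : Finset X) (_ : P.Nonempty) (_ : (P : Set X) ⊆ A), smtIn A P

/-! If `smt` is bounded by `c` on the finite subsets `P` of `A`, then every such `P` lies on a tree
of length about `c`. Cutting a tree from its leaves towards its root into pieces of diameter at
most `δ`, each of which uses up length at least `δ / 2`, covers `P` by a number of sets that does
not depend on `P`. By compactness (Rado's selection principle) one such cover works for all of `A`,
so `L*(A) ≤ L_MC(A)`.

Conversely, let `A` be connected and take an open cover of `A` by sets of diameter at most `δ`.
Any two points of `A` are joined by a path in the nerve of the cover. Starting from one point of
`P`, join the others one at a time: follow a path in the nerve back to a set already visited,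
choosing a point of `A` in each intersection of consecutive sets. Every set is crossed only once,
at a cost of at most its diameter, and each junction costs at most `δ`, so
`smt_A(P) ≤ ∑ diam + |P| δ`. -/

/-- `MetricTree r V l`: there is a tree with root `r` and vertex set `V` whose edges have total
length `l`. A tree is a single vertex, or arises from two trees by joining their roots. The vertex
sets of the two trees need not be disjoint, so the trees are really trees mapped into `X`. -/
inductive MetricTree {X : Type*} [PseudoEMetricSpace X] : X → Set X → ℝ≥0∞ → Prop
  | single (r : X) : MetricTree r {r} 0
  | join {r s : X} {V W : Set X} {l m : ℝ≥0∞} (hV : MetricTree r V l) (hW : MetricTree s W m) :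
      MetricTree r (V ∪ W) (l + m + edist r s)

/-- `HasFinCover δ c n A`: the set `A` is covered by `n` sets of diameter at most `δ` whose
diameters add up to at most `c`. Members of the cover may be empty. -/
def HasFinCover {X : Type*} [PseudoEMetricSpace X] (δ c : ℝ≥0∞) (n : ℕ) (A : Set X) : Prop :=
  ∃ B : Fin n → Set X, A ⊆ ⋃ i, B i ∧ (∀ i, Metric.ediam (B i) ≤ δ) ∧ ∑ i, Metric.ediam (B i) ≤ c

/-- `HasThriftyCover δ c A`: the set `A` is covered by finitely many sets of diameter at most `δ`
such that `c` bounds both the sum of the diameters and `δ / 2` times the number of sets. These are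
the covers obtained by cutting up a tree of length `c`. -/
def HasThriftyCover {X : Type*} [PseudoEMetricSpace X] (δ c : ℝ≥0∞) (A : Set X) : Prop :=
  ∃ n : ℕ, n * (δ / 2) ≤ c ∧ HasFinCover δ c n A

section Covers

variable {X : Type*} [PseudoEMetricSpace X] {A B : Set X} {δ c d : ℝ≥0∞} {m n : ℕ}

namespace HasFinCover

theorem mono (h : HasFinCover δ c n B) (hAB : A ⊆ B) (hcd : c ≤ d) : HasFinCover δ d n A := by
  obtain ⟨U, hU, hδ, hc⟩ := h
  exact ⟨U, hAB.trans hU, hδ, hc.trans hcd⟩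

protected theorem empty (n : ℕ) : HasFinCover δ c n (∅ : Set X) :=
  ⟨fun _ => ∅, by simp, by simp, by simp⟩

theorem of_ediam_le (hδ : Metric.ediam A ≤ δ) (hc : Metric.ediam A ≤ c) : HasFinCover δ c 1 A :=
  ⟨fun _ => A, by simp [Set.iUnion_const], fun _ => hδ, by simpa using hc⟩

theorem union (hA : HasFinCover δ c m A) (hB : HasFinCover δ d n B) :
    HasFinCover δ (c + d) (m + n) (A ∪ B) := by
  obtain ⟨U, hU, hδU, hcU⟩ := hA
  obtain ⟨W, hW, hδW, hcW⟩ := hB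
  refine ⟨Fin.append U W, Set.union_subset ?_ ?_, ?_, ?_⟩
  · exact hU.trans <| Set.iUnion_subset fun i =>
      Set.subset_iUnion_of_subset (i.castAdd n) (by rw [Fin.append_left])
  · exact hW.trans <| Set.iUnion_subset fun i =>
      Set.subset_iUnion_of_subset (i.natAdd m) (by rw [Fin.append_right])
  · exact Fin.addCases (by simpa using hδU) (by simpa using hδW)
  · simpa [Fin.sum_univ_add] using add_le_add hcU hcW

theorem of_le (h : HasFinCover δ c m A) (hmn : m ≤ n) : HasFinCover δ c n A := by
  simpa [Nat.add_sub_cancel' hmn] using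
    h.union (HasFinCover.empty (X := X) (δ := δ) (c := 0) (n - m))

end HasFinCover

namespace HasThriftyCover

protected theorem empty : HasThriftyCover δ 0 (∅ : Set X) := ⟨0, by simp, .empty 0⟩

theorem union (hA : HasThriftyCover δ c A) (hB : HasThriftyCover δ d B) :
    HasThriftyCover δ (c + d) (A ∪ B) := by
  obtain ⟨m, hm, hA⟩ := hA
  obtain ⟨n, hn, hB⟩ := hB
  refine ⟨m + n, ?_, hA.union hB⟩
  rw [Nat.cast_add, add_mul]
  exact add_le_add hm hn

theorem of_ediam_le (hδ : Metric.ediam A ≤ δ) (hc : Metric.ediam A ≤ c) (hδc : δ / 2 ≤ c) :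
    HasThriftyCover δ c A :=
  ⟨1, by simpa using hδc, .of_ediam_le hδ hc⟩

end HasThriftyCover

theorem ediam_eq_iSup_finset_inter (A : Set X) :
    Metric.ediam A = ⨆ s : Finset X, Metric.ediam (A ∩ s) := by
  classical
  refine le_antisymm (Metric.ediam_le fun x hx y hy => ?_)
    (iSup_le fun s => Metric.ediam_mono Set.inter_subset_left)
  exact le_iSup_of_le {x, y} (Metric.edist_le_ediam_of_mem ⟨hx, by simp⟩ ⟨hy, by simp⟩)

theorem exists_cover_forall_finset_inter_subset {α ι : Type*} [Finite ι] {A : Set α}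
    {B : Finset α → ι → Set α} (hB : ∀ s : Finset α, A ∩ s ⊆ ⋃ i, B s i) :
    ∃ C : ι → Set α, A ⊆ ⋃ i, C i ∧ ∀ s : Finset α, ∃ t, ∀ i, C i ∩ s ⊆ B t i := by
  rcases A.eq_empty_or_nonempty with rfl | ⟨a, ha⟩
  · exact ⟨fun _ => ∅, by simp, fun s => ⟨s, by simp⟩⟩
  have : Nonempty ι := (Set.mem_iUnion.1 (hB {a} ⟨ha, by simp⟩)).nonempty
  have hcolor (s : Finset α) (x : α) : ∃ i, x ∈ A ∩ s → x ∈ B s i := by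
    by_cases hx : x ∈ A ∩ s
    · exact (Set.mem_iUnion.1 (hB s hx)).imp fun i hi _ => hi
    · exact ⟨Classical.arbitrary ι, fun h => absurd h hx⟩
  choose color hcolor using hcolor
  obtain ⟨χ, hχ⟩ := Finset.rado_selection color
  refine ⟨fun i => {x ∈ A | χ x = i}, fun x hx => Set.mem_iUnion.2 ⟨χ x, hx, rfl⟩, fun s => ?_⟩
  obtain ⟨t, hst, ht⟩ := hχ s
  refine ⟨t, ?_⟩
  rintro _ x ⟨⟨hxA, rfl⟩, hxs⟩
  rw [ht x hxs]
  exact hcolor t x ⟨hxA, hst hxs⟩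

theorem HasFinCover.of_forall_finset
    (h : ∀ P : Finset X, (P : Set X) ⊆ A → HasFinCover δ c n (P : Set X)) :
    HasFinCover δ c n A := by
  classical
  have hfin (s : Finset X) : HasFinCover δ c n (A ∩ s) := by
    simpa [Set.inter_comm A, Set.sep_mem_eq] using! h (s.filter (· ∈ A)) (by simp [Set.subset_def])
  choose B hB hδ hc using hfin
  obtain ⟨C, hAC, hCB⟩ := exists_cover_forall_finset_inter_subset hB
  refine ⟨C, hAC, fun i => ?_, ?_⟩
  · rw [ediam_eq_iSup_finset_inter]
    refine iSup_le fun s => ?_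
    obtain ⟨t, ht⟩ := hCB s
    exact (Metric.ediam_mono (ht i)).trans (hδ t i)
  · have hmono (i : Fin n) : Monotone fun s : Finset X => Metric.ediam (C i ∩ s) := fun s t hst =>
      Metric.ediam_mono (Set.inter_subset_inter_right _ (Finset.coe_subset.2 hst))
    simp_rw [ediam_eq_iSup_finset_inter (C _)]
    rw [ENNReal.finsetSum_iSup_of_monotone hmono]
    refine iSup_le fun s => ?_
    obtain ⟨t, ht⟩ := hCB s
    exact (Finset.sum_le_sum fun i _ => Metric.ediam_mono (ht i)).trans (hc t)

end Covers

namespace MetricTree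

variable {X : Type*} [PseudoEMetricSpace X] {r s v : X} {V W : Set X} {l m : ℝ≥0∞}

theorem root_mem (h : MetricTree r V l) : r ∈ V := by
  induction h with
  | single r => exact rfl
  | join _ _ ih _ => exact Or.inl ih

theorem finite (h : MetricTree r V l) : V.Finite := by
  induction h with
  | single r => exact Set.finite_singleton r
  | join _ _ ih₁ ih₂ => exact ih₁.union ih₂

theorem attach (hV : MetricTree r V l) (hv : v ∈ V) (hW : MetricTree s W m) :
    MetricTree r (V ∪ W) (l + m + edist v s) := by
  induction hV with
  | single r =>
    obtain rfl : v = r := hv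
    exact (single v).join hW
  | join h₁ h₂ ih₁ ih₂ =>
    rcases hv with hv | hv
    · convert (ih₁ hv).join h₂ using 1
      · exact Set.union_right_comm ..
      · ring
    · convert h₁.join (ih₂ hv) using 1
      · exact Set.union_assoc ..
      · ring

theorem attach_leaf (hV : MetricTree r V l) (hv : v ∈ V) (x : X) :
    MetricTree r (insert x V) (l + edist v x) := by
  simpa using hV.attach hv (single x)

/-- Where two trees are joined, the pieces at their roots are merged as long as this keeps the
length `w` assigned to the piece at the new root below `δ / 2`. -/
theorem exists_cut (h : MetricTree r V l) (δ : ℝ≥0∞) :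
    ∃ (R U : Set X) (w c : ℝ≥0∞), r ∈ R ∧ V ⊆ R ∪ U ∧ Metric.ediam R ≤ w ∧ w ≤ δ / 2 ∧
      HasThriftyCover δ c U ∧ w + c ≤ l := by
  induction h with
  | single r => exact ⟨{r}, ∅, 0, 0, by simp, by simp, by simp, by simp, .empty, by simp⟩
  | @join r s V₁ V₂ l₁ l₂ _ _ ih₁ ih₂ =>
    obtain ⟨R₁, U₁, w₁, c₁, hr, hV₁, hR₁, hw₁, hU₁, hl₁⟩ := ih₁
    obtain ⟨R₂, U₂, w₂, c₂, hs, hV₂, hR₂, hw₂, hU₂, hl₂⟩ := ih₂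
    have hU := hU₁.union hU₂
    have hV : V₁ ∪ V₂ ⊆ R₁ ∪ R₂ ∪ (U₁ ∪ U₂) :=
      (Set.union_subset_union hV₁ hV₂).trans_eq (Set.union_union_union_comm ..)
    have hR : Metric.ediam (R₁ ∪ R₂) ≤ w₁ + (edist r s + w₂) :=
      (Metric.ediam_union_le_add_edist hr hs).trans (by rw [← add_assoc]; gcongr)
    have hl : w₁ + (edist r s + w₂) + (c₁ + c₂) ≤ l₁ + l₂ + edist r s := calc
      _ = (w₁ + c₁) + (w₂ + c₂) + edist r s := by ring
      _ ≤ _ := by gcongr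
    by_cases hmerge : w₁ + (edist r s + w₂) ≤ δ / 2
    · exact ⟨R₁ ∪ R₂, U₁ ∪ U₂, _, _, .inl hr, hV, hR, hmerge, hU, hl⟩
    rcases le_total (edist r s + w₂) (δ / 2) with hw | hw
    · have hw' : w₁ + (edist r s + w₂) ≤ δ := (add_le_add hw₁ hw).trans_eq (ENNReal.add_halves δ)
      have hcut := HasThriftyCover.of_ediam_le (hR.trans hw') hR (not_le.1 hmerge).le
      exact ⟨{r}, R₁ ∪ R₂ ∪ (U₁ ∪ U₂), 0, _, rfl, hV.trans Set.subset_union_right, by simp,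
        zero_le, hcut.union hU, by rwa [zero_add]⟩
    · have hcut := HasThriftyCover.of_ediam_le (hR₂.trans (hw₂.trans ENNReal.half_le_self))
        (hR₂.trans le_add_self) hw
      exact ⟨R₁, R₂ ∪ (U₁ ∪ U₂), w₁, _, hr, hV.trans_eq (Set.union_assoc ..), hR₁, hw₁,
        hcut.union hU, by rwa [← add_assoc]⟩

theorem exists_hasFinCover (h : MetricTree r V l) (δ : ℝ≥0∞) :
    ∃ n : ℕ, n * (δ / 2) ≤ l ∧ HasFinCover δ l (n + 1) V := by
  obtain ⟨R, U, w, c, -, hV, hR, hw, ⟨n, hn, hU⟩, hl⟩ := h.exists_cut δ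
  have hroot := HasFinCover.of_ediam_le (hR.trans (hw.trans ENNReal.half_le_self)) hR
  exact ⟨n, hn.trans (le_add_self.trans hl),
    (hU.union hroot).mono (hV.trans_eq (Set.union_comm ..)) (by rwa [add_comm])⟩

variable (X) in
theorem exists_forall_hasFinCover {δ c : ℝ≥0∞} (hδ : δ ≠ 0) (hc : c ≠ ∞) :
    ∃ N : ℕ, ∀ (r : X) (V : Set X) (l : ℝ≥0∞), MetricTree r V l → l ≤ c → HasFinCover δ c N V := by
  have hδ' : δ / 2 ≠ 0 := by simpa using hδ
  obtain ⟨N, hN⟩ := ENNReal.exists_nat_gt (ENNReal.div_ne_top hc hδ')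
  refine ⟨N, fun r V l h hl => ?_⟩
  obtain ⟨n, hn, hV⟩ := h.exists_hasFinCover δ
  have hnN : (n : ℝ≥0∞) < N :=
    ((ENNReal.le_div_iff_mul_le (.inl hδ') (.inr hc)).2 (hn.trans hl)).trans_lt hN
  exact (hV.of_le (Nat.succ_le_of_lt (by exact_mod_cast hnN))).mono subset_rfl hl

end MetricTree

section Graphs

theorem connected_finset_induction {V : Type*} [Fintype V] [DecidableEq V] {G : SimpleGraph V}
    (hG : G.Preconnected) {p : Finset V → Prop} (r : V) (singleton : p {r})
    (insert : ∀ (S : Finset V) (u v : V), u ∈ S → v ∉ S → G.Adj u v → p S → p (insert v S)) :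
    p Finset.univ := by
  obtain ⟨S, hS⟩ := Set.Finite.exists_maximal (Set.toFinite {S : Finset V | r ∈ S ∧ p S})
    ⟨{r}, by simp, singleton⟩
  obtain ⟨hrS, hpS⟩ := hS.prop
  suffices S = Finset.univ from this ▸ hpS
  refine Finset.eq_univ_of_forall fun v => by_contra fun hv => ?_
  obtain ⟨walk⟩ := hG r v
  obtain ⟨d, -, hfst, hsnd⟩ := walk.exists_boundary_dart (S : Set V) hrS hv
  exact hsnd (hS.le_of_ge ⟨Finset.mem_insert_of_mem hrS, insert S _ _ hfst hsnd d.adj hpS⟩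
    (Finset.subset_insert _ _) (Finset.mem_insert_self _ _))

variable {X : Type*} [MetricSpace X] {V : Finset X}

theorem MetricTree.exists_le_graphLength {G : SimpleGraph V} (hG : G.Preconnected) (r : V) :
    ∃ l ≤ graphLength G, MetricTree (r : X) (V : Set X) l := by
  classical
  suffices ∃ l ≤ ∑ e ∈ G.edgeFinset with e ∈ Finset.univ.sym2, edgeLength e,
      MetricTree (r : X) ((↑) '' ((Finset.univ : Finset V) : Set V)) l by
    simpa [graphLength] using this
  refine connected_finset_induction
    (p := fun S => ∃ l ≤ ∑ e ∈ G.edgeFinset with e ∈ S.sym2, edgeLength e,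
      MetricTree (r : X) ((↑) '' (S : Set V)) l)
    hG r ⟨0, zero_le, by simpa using .single (r : X)⟩ ?_
  rintro S u v hu hv huv ⟨l, hl, htree⟩
  refine ⟨l + edist (u : X) v, ?_, ?_⟩
  · calc l + edist (u : X) v
        ≤ edgeLength s(u, v) + ∑ e ∈ G.edgeFinset with e ∈ S.sym2, edgeLength e := by
          rw [add_comm]
          exact add_le_add_right hl _
      _ = ∑ e ∈ insert s(u, v) {e ∈ G.edgeFinset | e ∈ S.sym2}, edgeLength e :=
          (Finset.sum_insert fun h =>
            hv (Finset.mk_mem_sym2_iff.1 (Finset.mem_filter.1 h).2).2).symm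
      _ ≤ _ := Finset.sum_le_sum_of_subset (by
          have := Finset.sym2_mono (Finset.subset_insert v S)
          grind [SimpleGraph.mem_edgeFinset, SimpleGraph.mem_edgeSet, Finset.mk_mem_sym2_iff])
  · simpa [Set.image_insert_eq] using htree.attach_leaf (Set.mem_image_of_mem _ hu) (v : X)

theorem MetricTree.exists_of_smt_lt {P : Finset X} {c : ℝ≥0∞} (h : smt P < c) :
    ∃ (r : X) (V : Set X) (l : ℝ≥0∞), MetricTree r V l ∧ (P : Set X) ⊆ V ∧ l < c := by
  simp only [smt, iInf_lt_iff] at h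
  obtain ⟨V, hPV, G, hG, hGc⟩ := h
  obtain ⟨r⟩ := hG.nonempty
  obtain ⟨l, hl, htree⟩ := exists_le_graphLength hG.preconnected r
  exact ⟨r, V, l, htree, Finset.coe_subset.2 hPV, hl.trans_lt hGc⟩

theorem graphLength_le_tsum {G : SimpleGraph V} {E : Set (Sym2 X)}
    (h : ∀ a b : V, G.Adj a b → s((a : X), (b : X)) ∈ E) :
    graphLength G ≤ ∑' e : E, edgeLength (e : Sym2 X) := by
  classical
  have hlength (e : Sym2 V) : edgeLength e = edgeLength (e.map Subtype.val) := by
    induction e with | _ a b => rfl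
  have hE : ∀ e ∈ G.edgeSet, e.map Subtype.val ∈ E := fun e he => by
    induction e with | _ a b => exact h a b he
  calc graphLength G = ∑' e : G.edgeSet, edgeLength (e : Sym2 V) := by
        rw [graphLength, ← Finset.tsum_subtype', SimpleGraph.coe_edgeFinset]
    _ = ∑' e : G.edgeSet, edgeLength ((e : Sym2 V).map Subtype.val) :=
        tsum_congr fun e => hlength e
    _ ≤ ∑' e : E, edgeLength (e : Sym2 X) :=
        ENNReal.tsum_comp_le_tsum_of_injective (f := fun e : G.edgeSet => ⟨_, hE e e.2⟩)
          (fun e e' hee' => Subtype.ext (Sym2.map.injective Subtype.val_injective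
            (congrArg Subtype.val hee'))) (fun e : E => edgeLength (e : Sym2 X))

theorem exists_connected_subgraph_pair (r s : X) :
    ∃ H : (⊤ : SimpleGraph X).Subgraph, H.Connected ∧ H.verts = {r, s} ∧
      ∑' e : H.edgeSet, edgeLength (e : Sym2 X) ≤ edist r s := by
  rcases eq_or_ne r s with rfl | hrs
  · refine ⟨_, SimpleGraph.Subgraph.singletonSubgraph_connected (v := r),
      (Set.pair_eq_singleton r).symm, ?_⟩
    rw [SimpleGraph.edgeSet_singletonSubgraph, tsum_empty]
    exact zero_le
  · refine ⟨_, SimpleGraph.Subgraph.subgraphOfAdj_connected (G := ⊤) hrs, rfl, ?_⟩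
    rw [SimpleGraph.edgeSet_subgraphOfAdj, tsum_singleton s(r, s) edgeLength]
    rfl

theorem MetricTree.exists_connected_subgraph {r : X} {V : Set X} {l : ℝ≥0∞}
    (h : MetricTree r V l) :
    ∃ H : (⊤ : SimpleGraph X).Subgraph, H.Connected ∧ H.verts = V ∧
      ∑' e : H.edgeSet, edgeLength (e : Sym2 X) ≤ l := by
  induction h with
  | single r => simpa using exists_connected_subgraph_pair r r
  | @join r s _ _ l m hV hW ihV ihW =>
    obtain ⟨H, hH, rfl, hl⟩ := ihV
    obtain ⟨K, hK, rfl, hm⟩ := ihW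
    obtain ⟨E, hE, hEverts, hrs⟩ := exists_connected_subgraph_pair r s
    have hHE := SimpleGraph.Subgraph.connected_sup hH.preconnected hE.preconnected
      ⟨r, hV.root_mem, by simp [hEverts]⟩
    refine ⟨H ⊔ E ⊔ K, SimpleGraph.Subgraph.connected_sup hHE.preconnected hK.preconnected
      ⟨s, .inr (by simp [hEverts]), hW.root_mem⟩, ?_, ?_⟩
    · have hr := hV.root_mem
      have hs := hW.root_mem
      grind [SimpleGraph.Subgraph.verts_sup]
    · calc ∑' e : (H ⊔ E ⊔ K).edgeSet, edgeLength (e : Sym2 X) ≤ l + edist r s + m := by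
            rw [SimpleGraph.Subgraph.edgeSet_sup, SimpleGraph.Subgraph.edgeSet_sup]
            grw [ENNReal.tsum_union_le, ENNReal.tsum_union_le, hl, hm, hrs]
        _ = l + m + edist r s := add_right_comm ..

theorem MetricTree.exists_connected_graphLength_le {r : X} {l : ℝ≥0∞}
    (h : MetricTree r (V : Set X) l) : ∃ G : SimpleGraph V, G.Connected ∧ graphLength G ≤ l := by
  obtain ⟨H, hH, hV, hl⟩ := h.exists_connected_subgraph
  let G : SimpleGraph V := H.spanningCoe.comap (↑)
  let e : H.coe ≃g G := ⟨Equiv.setCongr hV, Iff.rfl⟩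
  exact ⟨G, e.connected_iff.1 hH.coe, (graphLength_le_tsum fun _ _ hab => hab).trans hl⟩

theorem MetricTree.smtIn_le {r : X} {V A : Set X} {l : ℝ≥0∞} (h : MetricTree r V l) {P : Finset X}
    (hP : (P : Set X) ⊆ V) (hV : V ⊆ A) : smtIn A P ≤ l := by
  lift V to Finset X using h.finite
  obtain ⟨G, hG, hGl⟩ := h.exists_connected_graphLength_le
  exact iInf₂_le_of_le V (Finset.coe_subset.1 hP) <|
    iInf₂_le_of_le (Set.sdiff_subset.trans hV) G <| iInf_le_of_le hG hGl

end Graphs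

/-- The nerve (more precisely, its 1-skeleton) of the family of sets `W i ∩ A`: two indices are
adjacent if the corresponding sets intersect inside `A`. -/
def nerveGraph {X ι : Type*} (A : Set X) (W : ι → Set X) : SimpleGraph ι :=
  SimpleGraph.fromRel fun i j => (A ∩ (W i ∩ W j)).Nonempty

section Nerve

variable {X ι : Type*} {A : Set X} {W : ι → Set X} {i j : ι}

theorem nonempty_inter_of_nerveGraph_adj (h : (nerveGraph A W).Adj i j) :
    (A ∩ (W i ∩ W j)).Nonempty := by
  rcases h.2 with h | h
  · exact h
  · rwa [Set.inter_comm (W i)]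

theorem nerveGraph_reachable_of_nonempty_inter (h : (A ∩ (W i ∩ W j)).Nonempty) :
    (nerveGraph A W).Reachable i j := by
  rcases eq_or_ne i j with rfl | hij
  · exact .refl _
  · exact SimpleGraph.Adj.reachable ⟨hij, .inl h⟩

theorem nerveGraph_reachable_of_isPreconnected [TopologicalSpace X] (hA : IsPreconnected A)
    (hW : ∀ i, IsOpen (W i)) (hAW : A ⊆ ⋃ i, W i) (hi : (A ∩ W i).Nonempty)
    (hj : (A ∩ W j).Nonempty) : (nerveGraph A W).Reachable i j := by
  have := isPreconnected_iff_preconnectedSpace.1 hA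
  let W' : ι → Set A := fun i => (↑) ⁻¹' W i
  have hW' : ⋃ i, W' i = Set.univ :=
    Set.eq_univ_of_forall fun x =>
      let ⟨i, hi⟩ := Set.mem_iUnion.1 (hAW x.2)
      Set.mem_iUnion.2 ⟨i, hi⟩
  have hchain : Relation.TransGen (fun i j => (W' i ∩ W' j).Nonempty) i j :=
    IsPreconnected.transGen_of_iUnion (hW' ▸ isPreconnected_univ)
      (fun i => (hW i).preimage continuous_subtype_val) i j
      (hi.elim fun x hx => ⟨⟨x, hx.1⟩, hx.2⟩) (hj.elim fun x hx => ⟨⟨x, hx.1⟩, hx.2⟩)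
  have hstep {k l : ι} : (W' k ∩ W' l).Nonempty → (nerveGraph A W).Reachable k l :=
    fun ⟨x, hx⟩ => nerveGraph_reachable_of_nonempty_inter ⟨x, x.2, hx⟩
  clear hj
  induction hchain with
  | single h => exact hstep h
  | tail _ h ih => exact ih.trans (hstep h)

end Nerve

/-- `IsSubordinateTree A W S c V`: the set `V` is the vertex set of a tree in `A` that meets `W k`
for all `k ∈ S`, and the length of the tree exceeds the sum of the diameters of these sets by at
most `c`. -/
structure IsSubordinateTree {X ι : Type*} [PseudoEMetricSpace X] (A : Set X) (W : ι → Set X)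
    (S : Finset ι) (c : ℝ≥0∞) (V : Set X) : Prop where
  subset : V ⊆ A
  inter_nonempty : ∀ k ∈ S, (V ∩ W k).Nonempty
  exists_metricTree : ∃ r l, MetricTree r V l ∧ l ≤ ∑ k ∈ S, Metric.ediam (W k) + c

namespace IsSubordinateTree

variable {X ι : Type*} [PseudoEMetricSpace X] {A V : Set X} {W : ι → Set X} {S : Finset ι}
  {c δ : ℝ≥0∞} {i j : ι} {x y : X}

protected theorem singleton (hx : x ∈ A ∩ W i) : IsSubordinateTree A W {i} c {x} where
  subset := Set.singleton_subset_iff.2 hx.1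
  inter_nonempty := by simpa using hx.2
  exists_metricTree := ⟨x, 0, .single x, zero_le⟩

theorem insert_of_mem (h : IsSubordinateTree A W S c V) (hi : i ∈ S)
    (hδ : Metric.ediam (W i) ≤ δ) (hx : x ∈ A ∩ W i) :
    IsSubordinateTree A W S (c + δ) (insert x V) where
  subset := Set.insert_subset hx.1 h.subset
  inter_nonempty k hk := (h.inter_nonempty k hk).mono (by gcongr; exact Set.subset_insert x V)
  exists_metricTree := by
    obtain ⟨r, l, htree, hl⟩ := h.exists_metricTree
    obtain ⟨v, hvV, hvi⟩ := h.inter_nonempty i hi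
    refine ⟨r, _, htree.attach_leaf hvV x, ?_⟩
    rw [← add_assoc]
    exact add_le_add hl ((Metric.edist_le_ediam_of_mem hvi hx.2).trans hδ)

theorem insert_of_notMem [DecidableEq ι] (h : IsSubordinateTree A W S c V) (hi : i ∉ S)
    (hy : y ∈ V ∩ W i) (hx : x ∈ A ∩ W i) :
    IsSubordinateTree A W (insert i S) c (insert x V) where
  subset := Set.insert_subset hx.1 h.subset
  inter_nonempty := by
    refine Finset.forall_mem_insert .. |>.2 ⟨⟨x, by simp, hx.2⟩, fun k hk => ?_⟩
    exact (h.inter_nonempty k hk).mono (by gcongr; exact Set.subset_insert x V)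
  exists_metricTree := by
    obtain ⟨r, l, htree, hl⟩ := h.exists_metricTree
    refine ⟨r, _, htree.attach_leaf hy.1 x, ?_⟩
    rw [Finset.sum_insert hi, add_assoc, add_comm l]
    exact add_le_add (Metric.edist_le_ediam_of_mem hy.2 hx.2) hl

/-- The bound on `T` makes sure that no set of the nerve is paid for twice along the path. -/
theorem exists_of_isPath (h : IsSubordinateTree A W S c V) (hδ : ∀ k, Metric.ediam (W k) ≤ δ)
    {p : (nerveGraph A W).Walk i j} (hp : p.IsPath) (hj : j ∈ S) (hx : x ∈ A ∩ W i) :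
    ∃ T U, S ⊆ T ∧ (∀ k ∈ T, k ∈ S ∨ k ∈ p.support) ∧ insert x V ⊆ U ∧
      IsSubordinateTree A W T (c + δ) U := by
  classical
  induction p generalizing x with
  | nil => exact ⟨S, insert x V, subset_rfl, fun k hk => .inl hk, subset_rfl,
      h.insert_of_mem hj (hδ _) hx⟩
  | @cons i k j hik p ih =>
    by_cases hi : i ∈ S
    · exact ⟨S, insert x V, subset_rfl, fun l hl => .inl hl, subset_rfl,
        h.insert_of_mem hi (hδ i) hx⟩
    obtain ⟨hp, hip⟩ := SimpleGraph.Walk.cons_isPath_iff .. |>.1 hp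
    obtain ⟨y, hyA, hyi, hyk⟩ := nonempty_inter_of_nerveGraph_adj hik
    obtain ⟨T, U, hST, hT, hVU, htree⟩ := ih hp hj ⟨hyA, hyk⟩
    have hiT : i ∉ T := fun h => (hT i h).elim hi hip
    refine ⟨insert i T, insert x U, hST.trans (Finset.subset_insert i T), ?_,
      Set.insert_subset_insert ((Set.subset_insert y V).trans hVU),
      htree.insert_of_notMem hiT ⟨hVU (Set.mem_insert y V), hyi⟩ hx⟩
    grind [SimpleGraph.Walk.support_cons]

theorem exists_of_finset (hA : IsPreconnected A) (hW : ∀ i, IsOpen (W i)) (hAW : A ⊆ ⋃ i, W i)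
    (hδ : ∀ i, Metric.ediam (W i) ≤ δ) {P : Finset X} (hne : P.Nonempty) (hP : (P : Set X) ⊆ A) :
    ∃ S V, S.Nonempty ∧ (P : Set X) ⊆ V ∧ IsSubordinateTree A W S (P.card * δ) V := by
  induction hne using Finset.Nonempty.cons_induction with
  | singleton x =>
    have hxA : x ∈ A := by simpa using hP
    obtain ⟨i, hi⟩ := Set.mem_iUnion.1 (hAW hxA)
    exact ⟨{i}, {x}, by simp, by simp, .singleton ⟨hxA, hi⟩⟩
  | cons x P hx _ ih =>
    rw [Finset.coe_cons, Set.insert_subset_iff] at hP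
    obtain ⟨S, V, ⟨j, hj⟩, hPV, htree⟩ := ih hP.2
    obtain ⟨i, hi⟩ := Set.mem_iUnion.1 (hAW hP.1)
    have hAj : (A ∩ W j).Nonempty := (htree.inter_nonempty j hj).mono (by grw [htree.subset])
    obtain ⟨p, hp⟩ := (nerveGraph_reachable_of_isPreconnected hA hW hAW ⟨x, hP.1, hi⟩
      hAj).exists_isPath
    obtain ⟨T, U, hST, -, hVU, htree'⟩ := htree.exists_of_isPath hδ hp hj ⟨hP.1, hi⟩
    refine ⟨T, U, ⟨j, hST hj⟩, ?_, ?_⟩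
    · rw [Finset.coe_cons]
      exact (Set.insert_subset_insert hPV).trans hVU
    · rwa [Finset.card_cons, Nat.cast_succ, add_one_mul]

end IsSubordinateTree

section Lengths

variable {X : Type*} [MetricSpace X] {A : Set X} {δ : ℝ≥0} {c : ℝ≥0∞}

theorem outerLinearPremeasure_le_tsum {ι : Type*} [Countable ι] {B : ι → Set X} (hA : A ⊆ ⋃ i, B i)
    (hδ : ∀ i, Metric.ediam (B i) ≤ δ) : outerLinearPremeasure δ A ≤ ∑' i, Metric.ediam (B i) := by
  obtain ⟨f, hf⟩ := exists_injective_nat ι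
  let U : ℕ → Set X := Function.extend f B ⊥
  have hU : (fun k => Metric.ediam (U k)) = Function.extend f (fun i => Metric.ediam (B i)) 0 := by
    have hbot : Metric.ediam ∘ (⊥ : ℕ → Set X) = 0 := funext fun _ => Metric.ediam_empty
    funext k
    rw [Function.apply_extend Metric.ediam, hbot]
    rfl
  refine iInf₂_le_of_le U (hA.trans_eq (iSup_extend_bot hf B).symm) <| iInf_le_of_le ?_ ?_
  · intro k
    by_cases hk : ∃ i, f i = k
    · obtain ⟨i, rfl⟩ := hk
      exact (congrArg _ (hf.extend_apply B ⊥ i)).trans_le (hδ i)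
    · exact (congrArg _ (Function.extend_apply' B ⊥ k hk)).trans_le (by simp)
  · rw [hU, tsum_extend_zero hf]

theorem HasFinCover.outerLinearPremeasure_le {n : ℕ} (h : HasFinCover δ c n A) :
    outerLinearPremeasure δ A ≤ c := by
  obtain ⟨B, hA, hδ, hc⟩ := h
  exact (outerLinearPremeasure_le_tsum hA hδ).trans (by rwa [tsum_fintype])

theorem outerLinearMeasure_le_mengerChoquetLength (A : Set X) :
    outerLinearMeasure A ≤ mengerChoquetLength A := by
  refine iSup₂_le fun δ hδ => le_of_forall_gt_imp_ge_of_dense fun c hc => ?_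
  rcases eq_or_ne c ∞ with rfl | hctop
  · exact le_top
  obtain ⟨N, hN⟩ := MetricTree.exists_forall_hasFinCover X (ENNReal.coe_ne_zero.2 hδ.ne') hctop
  suffices HasFinCover δ c N A from this.outerLinearPremeasure_le
  refine .of_forall_finset fun P hPA => ?_
  rcases P.eq_empty_or_nonempty with rfl | hne
  · simpa using HasFinCover.empty N
  have hsmt : smt P ≤ mengerChoquetLength A := le_iSup₂_of_le P hne (le_iSup_of_le hPA le_rfl)
  obtain ⟨r, V, l, htree, hPV, hl⟩ := MetricTree.exists_of_smt_lt (hsmt.trans_lt hc)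
  exact (hN r V l htree hl.le).mono hPV le_rfl

theorem smt_le_smtIn (A : Set X) (P : Finset X) : smt P ≤ smtIn A P :=
  iInf₂_mono fun _ _ => le_iInf fun _ => le_rfl

theorem mengerChoquetLength_le_intrinsicMengerLength (A : Set X) :
    mengerChoquetLength A ≤ intrinsicMengerLength A :=
  iSup_mono fun P => iSup₂_mono fun _ _ => smt_le_smtIn A P

theorem exists_open_cover_of_outerLinearMeasure_lt (hc : outerLinearMeasure A < c) (hδ : 0 < δ) :
    ∃ W : ℕ → Set X, (∀ i, IsOpen (W i)) ∧ A ⊆ ⋃ i, W i ∧ (∀ i, Metric.ediam (W i) ≤ δ) ∧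
      ∑' i, Metric.ediam (W i) ≤ c := by
  have hle : outerLinearPremeasure (δ / 2) A ≤ outerLinearMeasure A :=
    le_iSup₂ (f := fun (ε : ℝ≥0) (_ : 0 < ε) => outerLinearPremeasure ε A) (δ / 2) (half_pos hδ)
  have hlt := hle.trans_lt hc
  simp only [outerLinearPremeasure, iInf_lt_iff] at hlt
  obtain ⟨U, hAU, hUδ, hUc⟩ := hlt
  obtain ⟨η, hη, hηsum⟩ := ENNReal.exists_pos_sum_of_countable
    (ε := min (δ / 2 : ℝ≥0∞) (c - ∑' i, Metric.ediam (U i)) / 2)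
    (by simp [hδ.ne', tsub_eq_zero_iff_le, hUc]) ℕ
  have hηsum : ∑' i, 2 * (η i : ℝ≥0∞) ≤ min (δ / 2 : ℝ≥0∞) (c - ∑' i, Metric.ediam (U i)) := by
    rw [ENNReal.tsum_mul_left]
    exact (mul_le_mul_right hηsum.le _).trans ENNReal.mul_div_le
  have hdiam (i : ℕ) : Metric.ediam (Metric.thickening (η i) (U i)) ≤
      Metric.ediam (U i) + 2 * η i := Metric.ediam_thickening_le _
  refine ⟨fun i => Metric.thickening (η i) (U i), fun i => Metric.isOpen_thickening,
    hAU.trans (Set.iUnion_mono fun i => Metric.self_subset_thickening (hη i) _), fun i => ?_, ?_⟩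
  · calc Metric.ediam (Metric.thickening (η i) (U i)) ≤ δ / 2 + δ / 2 :=
          (hdiam i).trans <| add_le_add (by simpa using hUδ i) <|
            (ENNReal.le_tsum i).trans (hηsum.trans (min_le_left ..))
      _ = δ := ENNReal.add_halves _
  · calc ∑' i, Metric.ediam (Metric.thickening (η i) (U i))
        ≤ ∑' i, Metric.ediam (U i) + ∑' i, 2 * (η i : ℝ≥0∞) :=
          (ENNReal.tsum_le_tsum hdiam).trans_eq ENNReal.tsum_add
      _ ≤ ∑' i, Metric.ediam (U i) + (c - ∑' i, Metric.ediam (U i)) :=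
          add_le_add_right (hηsum.trans (min_le_right ..)) _
      _ = c := add_tsub_cancel_of_le hUc.le

theorem smtIn_le_tsum_add {ι : Type*} {W : ι → Set X} {δ : ℝ≥0∞} (hA : IsPreconnected A)
    (hW : ∀ i, IsOpen (W i)) (hAW : A ⊆ ⋃ i, W i) (hδ : ∀ i, Metric.ediam (W i) ≤ δ)
    {P : Finset X} (hne : P.Nonempty) (hP : (P : Set X) ⊆ A) :
    smtIn A P ≤ ∑' i, Metric.ediam (W i) + P.card * δ := by
  obtain ⟨S, V, -, hPV, htree⟩ := IsSubordinateTree.exists_of_finset hA hW hAW hδ hne hP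
  obtain ⟨r, l, h, hl⟩ := htree.exists_metricTree
  exact (h.smtIn_le hPV htree.subset).trans (hl.trans (by grw [ENNReal.sum_le_tsum]))

theorem smtIn_le_outerLinearMeasure (hA : IsPreconnected A) {P : Finset X} (hne : P.Nonempty)
    (hP : (P : Set X) ⊆ A) : smtIn A P ≤ outerLinearMeasure A := by
  refine le_of_forall_gt_imp_ge_of_dense fun c hc =>
    ENNReal.le_of_forall_pos_le_add fun ε hε _ => ?_
  have hcard : (0 : ℝ≥0) < P.card := by simpa using hne
  obtain ⟨W, hW, hAW, hδ, hWc⟩ :=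
    exists_open_cover_of_outerLinearMeasure_lt hc (div_pos hε hcard)
  calc smtIn A P ≤ ∑' i, Metric.ediam (W i) + P.card * (ε / P.card : ℝ≥0) :=
        smtIn_le_tsum_add hA hW hAW hδ hne hP
    _ ≤ c + ε := add_le_add hWc (by exact_mod_cast (mul_div_cancel₀ ε hcard.ne').le)

theorem intrinsicMengerLength_le_outerLinearMeasure (hA : IsPreconnected A) :
    intrinsicMengerLength A ≤ outerLinearMeasure A :=
  iSup_le fun _ => iSup₂_le fun hne hP => smtIn_le_outerLinearMeasure hA hne hP

end Lengths

/-- `IsPreconnected` is topological connectedness with the empty set allowed. -/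
theorem mainTheorem1 {X : Type*} [MetricSpace X] (A : Set X) :
    (outerLinearMeasure A ≤ mengerChoquetLength A ∧
      mengerChoquetLength A ≤ intrinsicMengerLength A) ∧
    (IsPreconnected A →
      outerLinearMeasure A = mengerChoquetLength A ∧
        mengerChoquetLength A = intrinsicMengerLength A) := by
  have h₁ := outerLinearMeasure_le_mengerChoquetLength A
  have h₂ := mengerChoquetLength_le_intrinsicMengerLength A
  refine ⟨⟨h₁, h₂⟩, fun hA => ?_⟩
  have h₃ := intrinsicMengerLength_le_outerLinearMeasure hA
  exact ⟨h₁.antisymm (h₂.trans h₃), h₂.antisymm (h₃.trans h₁)⟩
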